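/- Let $F$ be a real $n\times n$ matrix that is stable (all its complex eigenvalues have negative real part), with characteristic polynomial $\det(sI-F)=s^n+\gamma_{n-1}s^{n-1}+\cdots+\gamma_1 s+\gamma_0$, and suppose that in the complex Jordan form of $F$ every eigenvalue has exactly one Jordan block. Suppose that $\beta_0\neq 0$ is a real number such that the polynomial $p(s)=s^n+\gamma_{n-1}s^{n-1}+\cdots+\gamma_1 s+\gamma_0-\beta_0$ is stable (all its complex roots have negative real part), and let $n_i$ be the number of pairs of complex conjugate non-real roots of $p$, counted with multiplicity. Then there exists a real $n\times n$ matrix $H$ such that $F+\alpha H$ has $\lfloor\frac{n-n_i}{2}\rfloor+1$ disconnected stable regions with respect to the real parameter $\alpha$: the set $S=\{\alpha\in\mathbb{R} : F+\alpha H \text{ is stable}\}$ has exactly $\lfloor\frac{n-n_i}{2}\rfloor+1$ connected components, and so does its part $S\cap(-\infty,0)$ in the negative half-line. -/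

import Mathlib

open Polynomial

/-- A real polynomial is stable if all its complex roots lie in the open left half-plane. -/
def PolyStable (p : ℝ[X]) : Prop :=
  ∀ z : ℂ, aeval z p = 0 → z.re < 0

/-- A real square matrix is stable if all its complex eigenvalues lie in the open left
half-plane. -/
def MatrixStable {n : ℕ} (A : Matrix (Fin n) (Fin n) ℝ) : Prop :=
  ∀ z ∈ spectrum ℂ (A.map (algebraMap ℝ ℂ)), z.re < 0

/-- The Jordan block of size `m` with eigenvalue `c`. -/
def jordanBlock (m : ℕ) (c : ℂ) : Matrix (Fin m) (Fin m) ℂ :=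
  Matrix.of fun i j => if i = j then c else if (i : ℕ) + 1 = (j : ℕ) then 1 else 0

/-- The complex Jordan normal form of `A` consists of (nonempty) Jordan blocks whose eigenvalues
are pairwise distinct: every eigenvalue of `A` has exactly one Jordan block. -/
def OneJordanBlockPerEigenvalue {n : ℕ} (A : Matrix (Fin n) (Fin n) ℝ) : Prop :=
  ∃ (r : ℕ) (size : Fin r → ℕ) (ev : Fin r → ℂ) (e : (Σ i, Fin (size i)) ≃ Fin n)
    (P : (Matrix (Fin n) (Fin n) ℂ)ˣ),
    (∀ i, 0 < size i) ∧ Function.Injective ev ∧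
    A.map (algebraMap ℝ ℂ) =
      (P : Matrix (Fin n) (Fin n) ℂ) *
        Matrix.reindex e e (Matrix.blockDiagonal' fun i => jordanBlock (size i) (ev i)) *
        ((P⁻¹ : (Matrix (Fin n) (Fin n) ℂ)ˣ) : Matrix (Fin n) (Fin n) ℂ)

open Classical in
/-- The number of pairs of complex conjugate non-real roots of a real polynomial, counted with
multiplicity: each pair has exactly one member in the open upper half-plane. -/
noncomputable def conjugatePairs (p : ℝ[X]) : ℕ :=
  ((p.aroots ℂ).filter fun z => 0 < z.im).card

/-- The stability region of the pencil `F + α H` in the real parameter `α`. -/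
def stabilityRegion {n : ℕ} (F H : Matrix (Fin n) (Fin n) ℝ) : Set ℝ :=
  {α : ℝ | MatrixStable (F + α • H)}

/-- The number of connected components of a set of real numbers. -/
noncomputable def numComponents (S : Set ℝ) : ℕ :=
  Nat.card (ConnectedComponents S)

/-! One Jordan block per eigenvalue means that `F` has a cyclic vector `v`. Write `p` for the stable
polynomial `F.charpoly - C β₀`, so that `p(F) = -β₀`. Choose monic polynomials `B 0, …, B n = p` by
a three-term recursion; the vectors `e i = B i (F) v` form a basis linked by `e i ↦ e (i + 1)`, and
the last link closes up through `e n = -β₀ v`. Let `H` rescale links, `e i ↦ h i • e (i + 1)`. If no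
rescaled link lies under a nonzero coefficient `c (i + 1)`, then `F + α H` has characteristic
polynomial `p + β₀ ∏ (1 + α h i)` (`IsThreeTerm.exists_matrix_deformation`). Splitting `p` into real
linear and quadratic factors blocks only one link per conjugate pair (`exists_isThreeTerm`).

Stability thus depends only on the scalar `t = ∏ (1 + α h i)`. The set `T` of those `t` for which `p
+ β₀ t` is stable contains `0`, is an interval (`ordConnected_setOf_polyStable`), and is bounded
when `n ≥ 3` (`exists_bound_of_polyStable`). Give the product negative roots so far apart that it
leaves `T` between neighbours. Between roots its absolute value is log-concave, so each root
accounts for exactly one component of the preimage of `T` (`numComponents_rootProd_preimage`). All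
roots are negative, so the count is the same on the negative half-line. For `n = 2` the set `T` is
unbounded on one side, but the product is negative between its two roots, so a lower bound on `T` is
enough. -/

/-! ### From distinct Jordan blocks to a cyclic vector. -/

theorem aeval_blockDiagonal' {ι : Type*} [Fintype ι] [DecidableEq ι] {m : ι → Type*}
    [∀ i, Fintype (m i)] [∀ i, DecidableEq (m i)] {R : Type*} [CommRing R]
    (M : ∀ i, Matrix (m i) (m i) R) (q : R[X]) :
    aeval (Matrix.blockDiagonal' M) q = Matrix.blockDiagonal' fun i => aeval (M i) q := by
  have h : ∀ a : R, Matrix.blockDiagonal' (fun i => algebraMap R (Matrix (m i) (m i) R) a)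
      = algebraMap R _ a := by
    intro a
    simp_rw [Algebra.algebraMap_eq_smul_one]
    exact (Matrix.blockDiagonal'_smul a (1 : ∀ i, Matrix (m i) (m i) R)).trans
      (by rw [Matrix.blockDiagonal'_one])
  let φ : (∀ i, Matrix (m i) (m i) R) →ₐ[R] Matrix (Σ i, m i) (Σ i, m i) R :=
    { Matrix.blockDiagonal'RingHom m R with commutes' := h }
  have h2 : φ M = Matrix.blockDiagonal' M := rfl
  rw [← h2, aeval_algHom_apply]
  change Matrix.blockDiagonal' (aeval M q) = _
  congr 1
  funext i
  exact (aeval_algHom_apply (Pi.evalAlgHom R (fun i => Matrix (m i) (m i) R) i) M q).symm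

theorem aeval_units_conj {R A : Type*} [CommRing R] [Ring A] [Algebra R A] (P : Aˣ) (M : A)
    (q : R[X]) : aeval ((P : A) * M * ((P⁻¹ : Aˣ) : A)) q = P * aeval M q * ((P⁻¹ : Aˣ) : A) := by
  induction q using Polynomial.induction_on with
  | C a => simp [← Algebra.commutes]
  | add p q hp hq => simp [hp, hq, mul_add, add_mul]
  | monomial n a h =>
    rw [pow_succ, ← mul_assoc, map_mul, h, map_mul _ _ X, aeval_X, aeval_X]
    simp [mul_assoc]

/-- The `i`-th power of the nilpotent block has its ones on the `i`-th superdiagonal, so the top row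
reads off coefficients. -/
theorem aeval_nilpotent_jordanBlock_row_zero {m : ℕ} [NeZero m] (r : ℂ[X]) (j : Fin m) :
    (aeval (jordanBlock m 0) r) 0 j = r.coeff j := by
  have hpow : ∀ (i : ℕ) (j : Fin m),
      (jordanBlock m 0 ^ i) 0 j = if i = (j : ℕ) then 1 else 0 := by
    intro i
    induction i with
    | zero =>
      intro j
      rw [pow_zero, Matrix.one_apply]
      exact if_congr (by rw [Fin.ext_iff, Fin.val_zero]) rfl rfl
    | succ i ih =>
      intro j
      rw [pow_succ, Matrix.mul_apply]
      simp_rw [ih]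
      simp only [jordanBlock, Matrix.of_apply]
      by_cases hi : i < m
      · rw [Finset.sum_eq_single ⟨i, hi⟩]
        · by_cases h : i + 1 = (j : ℕ)
          · have : ¬ (i = (j : ℕ)) := by omega
            simp [h, Fin.ext_iff, this]
          · simp [h]
        · intro b _ hb
          rw [if_neg, zero_mul]
          rintro rfl
          exact hb rfl
        · simp
      · rw [Finset.sum_eq_zero, if_neg]
        · have := j.2; omega
        · intro b _
          rw [if_neg, zero_mul]
          have := b.2; omega
  induction r using Polynomial.induction_on' with
  | add p q hp hq => simp [hp, hq]
  | monomial n a => simp [aeval_monomial, Algebra.algebraMap_eq_smul_one, hpow, coeff_monomial]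

theorem pow_dvd_of_aeval_jordanBlock_eq_zero {m : ℕ} {c : ℂ} {q : ℂ[X]}
    (h : aeval (jordanBlock m c) q = 0) : (X - C c) ^ m ∣ q := by
  rcases Nat.eq_zero_or_pos m with rfl | hm
  · simp
  have : NeZero m := ⟨hm.ne'⟩
  -- Translating by `c` reduces to the nilpotent block: the first `m` coefficients of `q(X + c)`
  -- vanish.
  have hJ : jordanBlock m c = aeval (jordanBlock m 0) (X + C c) := by
    ext i j
    simp only [map_add, aeval_X, aeval_C, Algebra.algebraMap_eq_smul_one, jordanBlock,
      Matrix.of_apply, Matrix.add_apply, Matrix.smul_apply, Matrix.one_apply, smul_eq_mul]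
    by_cases hij : i = j <;> simp [hij]
  rw [X_sub_C_pow_dvd_iff, X_pow_dvd_iff]
  intro d hd
  rw [← aeval_nilpotent_jordanBlock_row_zero (m := m) _ ⟨d, hd⟩, aeval_comp, ← hJ, h]
  rfl

/-- An annihilating polynomial is divisible by `(X - ev i) ^ size i` for every block; distinct
eigenvalues make these coprime, and their product already has degree `n`. -/
theorem OneJordanBlockPerEigenvalue.eq_zero_of_aeval_eq_zero {n : ℕ}
    {F : Matrix (Fin n) (Fin n) ℝ} (hF : OneJordanBlockPerEigenvalue F) {q : ℝ[X]}
    (hq : q.degree < n) (h : aeval F q = 0) : q = 0 := by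
  obtain ⟨r, size, ev, e, P, -, hev, hP⟩ := hF
  have h1 : aeval (F.map (algebraMap ℝ ℂ)) (q.map (algebraMap ℝ ℂ)) = 0 := by
    rw [aeval_map_algebraMap]
    have := aeval_algHom_apply (Algebra.ofId ℝ ℂ).mapMatrix F q
    rw [h, map_zero] at this
    exact this
  have h2 : aeval (Matrix.blockDiagonal' fun i => jordanBlock (size i) (ev i))
      (q.map (algebraMap ℝ ℂ)) = 0 := by
    rw [hP, aeval_units_conj] at h1
    have h3 : aeval (Matrix.reindex e e
        (Matrix.blockDiagonal' fun i => jordanBlock (size i) (ev i)))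
        (q.map (algebraMap ℝ ℂ)) = 0 := by
      have := congrArg (fun M => ((P⁻¹ : (Matrix (Fin n) (Fin n) ℂ)ˣ) :
        Matrix (Fin n) (Fin n) ℂ) * M * P) h1
      simpa [mul_assoc] using this
    have h4 := aeval_algHom_apply (Matrix.reindexAlgEquiv ℂ ℂ e)
      (Matrix.blockDiagonal' fun i => jordanBlock (size i) (ev i)) (q.map (algebraMap ℝ ℂ))
    rw [Matrix.coe_reindexAlgEquiv, h3] at h4
    exact (map_eq_zero_iff _ (Matrix.reindexAlgEquiv ℂ ℂ e).injective).1 h4.symm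
  rw [aeval_blockDiagonal'] at h2
  have h5 : ∀ i, (X - C (ev i)) ^ size i ∣ q.map (algebraMap ℝ ℂ) := fun i =>
    pow_dvd_of_aeval_jordanBlock_eq_zero <| by
      have := congrFun (Matrix.blockDiagonal'_injective (h2.trans
        (Matrix.blockDiagonal'_zero).symm)) i
      exact this
  have h6 : ∏ i, (X - C (ev i)) ^ size i ∣ q.map (algebraMap ℝ ℂ) :=
    Finset.prod_dvd_of_coprime (fun i _ j _ hij => IsCoprime.pow
      (isCoprime_X_sub_C_of_isUnit_sub (sub_ne_zero.2 (hev.ne hij)).isUnit)) fun i _ => h5 i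
  have hdeg : (∏ i, (X - C (ev i)) ^ size i).degree = (n : WithBot ℕ) := by
    have : ∑ i, size i = n := by simpa using Fintype.card_congr e
    rw [degree_prod]
    simp only [degree_pow, degree_X_sub_C, nsmul_one]
    exact_mod_cast this
  rw [← Polynomial.map_eq_zero (algebraMap ℝ ℂ)]
  refine eq_zero_of_dvd_of_degree_lt h6 ?_
  rw [hdeg, degree_map]
  exact hq

/-- `v` generates the space under `T`, in the sense that no nonzero polynomial of degree less
than `n` in `T` annihilates it. -/
def IsCyclicVector {V : Type*} [AddCommGroup V] [Module ℝ V] (n : ℕ) (T : Module.End ℝ V)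
    (v : V) : Prop :=
  ∀ q : ℝ[X], q.degree < n → aeval T q v = 0 → q = 0

/-- A finitely generated torsion module over the principal ideal domain `ℝ[X]` has an element whose
annihilator is that of the whole module. -/
theorem OneJordanBlockPerEigenvalue.exists_isCyclicVector {n : ℕ}
    {F : Matrix (Fin n) (Fin n) ℝ} (hF : OneJordanBlockPerEigenvalue F) :
    ∃ v, IsCyclicVector n (Matrix.toLin' F) v := by
  obtain ⟨x, hx⟩ := Module.exists_ker_toSpanSingleton_eq_annihilator ℝ[X]
    (Module.AEval' (Matrix.toLin' F))
  obtain ⟨v, rfl⟩ := (Module.AEval'.of _).surjective x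
  refine ⟨v, fun q hq h => hF.eq_zero_of_aeval_eq_zero hq ?_⟩
  have h1 : q ∈ Module.annihilator ℝ[X] (Module.AEval' (Matrix.toLin' F)) := by
    rw [← hx, LinearMap.mem_ker, LinearMap.toSpanSingleton_apply]
    have := Module.AEval.of_aeval_smul (R := ℝ) (Matrix.toLin' F) q v
    rw [Module.End.smul_def, h, map_zero] at this
    exact this.symm
  have h2 : aeval (Matrix.toLin' F) q = 0 := by
    rw [← span_minpoly_eq_annihilator, Ideal.mem_span_singleton] at h1
    exact minpoly.dvd_iff.1 h1
  have h3 := aeval_algHom_apply (Matrix.toLinAlgEquiv' (R := ℝ) (n := Fin n)) F q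
  rw [show (Matrix.toLinAlgEquiv' (R := ℝ) (n := Fin n)) F = Matrix.toLin' F from rfl, h2] at h3
  exact (map_eq_zero_iff _ (Matrix.toLinAlgEquiv' (R := ℝ) (n := Fin n)).injective).1 h3.symm

/-! ### Three-term recursions ending at a given real polynomial. -/

/-- The polynomials `B 0, …, B n` satisfy the three-term recursion with coefficients `a`, `c`. -/
structure IsThreeTerm (n : ℕ) (B : ℕ → ℝ[X]) (a c : ℕ → ℝ) : Prop where
  zero : B 0 = 1
  succ : ∀ i < n, B (i + 1) = (X - C (a i)) * B i - C (c i) * B (i - 1)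

theorem IsThreeTerm.monic_natDegree {n : ℕ} {B : ℕ → ℝ[X]} {a c : ℕ → ℝ}
    (hB : IsThreeTerm n B a c) (i : ℕ) (hi : i ≤ n) : (B i).Monic ∧ (B i).natDegree = i := by
  induction i using Nat.strong_induction_on with
  | _ i ih =>
    rcases i with _ | i
    · simp [hB.zero]
    · obtain ⟨h1, h2⟩ := ih i (by omega) (by omega)
      obtain ⟨h3, h4⟩ := ih (i - 1) (by omega) (by omega)
      rw [hB.succ i (by omega)]
      have hm : ((X - C (a i)) * B i).Monic := (monic_X_sub_C _).mul h1
      have hd : ((X - C (a i)) * B i).natDegree = i + 1 := by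
        rw [(monic_X_sub_C _).natDegree_mul h1, natDegree_X_sub_C, h2, add_comm]
      have hlt : (C (c i) * B (i - 1)).degree < ((X - C (a i)) * B i).degree := by
        rw [degree_eq_natDegree hm.ne_zero, hd]
        refine lt_of_le_of_lt degree_le_natDegree ?_
        have := natDegree_C_mul_le (c i) (B (i - 1))
        exact_mod_cast (by omega : (C (c i) * B (i - 1)).natDegree < i + 1)
      exact ⟨hm.sub_of_left hlt, (natDegree_eq_of_degree_eq
        (degree_sub_eq_left_of_degree_lt hlt)).trans hd⟩

theorem conjugatePairs_mul {p q : ℝ[X]} (h : p * q ≠ 0) :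
    conjugatePairs (p * q) = conjugatePairs p + conjugatePairs q := by
  classical
  unfold conjugatePairs
  rw [aroots_mul h, Multiset.filter_add, Multiset.card_add]

theorem one_le_conjugatePairs {p : ℝ[X]} (h0 : p ≠ 0) {z : ℂ} (h : aeval z p = 0)
    (hz : z.im ≠ 0) : 1 ≤ conjugatePairs p := by
  classical
  unfold conjugatePairs
  refine Nat.succ_le_of_lt (Multiset.card_pos_iff_exists_mem.2 ?_)
  rcases lt_or_gt_of_ne hz with hz | hz
  · refine ⟨starRingEnd ℂ z, Multiset.mem_filter.2 ⟨(mem_aroots).2 ⟨h0, ?_⟩, by simpa using hz⟩⟩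
    rw [aeval_conj, h, map_zero]
  · exact ⟨z, Multiset.mem_filter.2 ⟨(mem_aroots).2 ⟨h0, h⟩, hz⟩⟩

/-- A monic polynomial is the last term of a three-term recursion in which at most one
coefficient `c` per pair of conjugate non-real roots does not vanish. -/
theorem exists_isThreeTerm (n : ℕ) (p : ℝ[X]) (hp : p.Monic) (hn : p.natDegree = n) :
    ∃ (B : ℕ → ℝ[X]) (a c : ℕ → ℝ) (D : Finset ℕ), IsThreeTerm n B a c ∧ B n = p ∧
      D ⊆ Finset.range n ∧ (∀ i ∈ D, i + 1 < n → c (i + 1) = 0) ∧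
      n ≤ D.card + conjugatePairs p := by
  induction n using Nat.strong_induction_on generalizing p with
  | _ n ih =>
    rcases n with _ | n
    · refine ⟨fun _ => 1, 0, 0, ∅, ⟨rfl, by simp⟩, ?_, by simp, by simp, by simp⟩
      exact (hp.natDegree_eq_zero.1 hn).symm
    have hdeg : p.degree ≠ 0 := by
      rw [degree_eq_natDegree hp.ne_zero, hn]
      exact_mod_cast n.succ_ne_zero
    obtain ⟨z, hz⟩ : ∃ z : ℂ, aeval z p = 0 := IsAlgClosed.exists_aeval_eq_zero _ p hdeg
    by_cases him : z.im = 0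
    · have hdvd : X - C z.re ∣ p := by
        rw [dvd_iff_isRoot, IsRoot]
        have hz' : z = (z.re : ℂ) := Complex.ext rfl (by simp [him])
        rw [hz'] at hz
        have := aeval_algebraMap_apply ℂ z.re p
        rw [Complex.coe_algebraMap, hz] at this
        simpa using this.symm
      obtain ⟨q, rfl⟩ := hdvd
      have hq : q.Monic := (monic_X_sub_C _).of_mul_monic_left hp
      rw [(monic_X_sub_C _).natDegree_mul hq, natDegree_X_sub_C] at hn
      obtain ⟨B, a, c, D, hB, hBn, hD, hc, hcard⟩ := ih n (by omega) q hq (by omega)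
      -- A real root appends a two-term step: `c n = 0`, so the new link is free and the link just
      -- before it stays free.
      refine ⟨Function.update B (n + 1) ((X - C z.re) * q), Function.update a n z.re,
        Function.update c n 0, insert n D, ⟨?_, fun i hi => ?_⟩, by simp, ?_, ?_, ?_⟩
      · simp [hB.zero]
      · rcases Nat.lt_succ_iff_lt_or_eq.1 hi with hi | rfl
        · have e2 : i ≠ n + 1 := by omega
          have e3 : i - 1 ≠ n + 1 := by omega
          simp [e2, e3, hi.ne, hB.succ i hi]
        · simp [hBn]
      · rw [Finset.insert_subset_iff]
        exact ⟨by simp, hD.trans (Finset.range_mono (by omega))⟩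
      · intro i hi hin
        rw [Finset.mem_insert] at hi
        by_cases h : i + 1 = n
        · simp [h]
        · rw [Function.update_of_ne h]
          rcases hi with rfl | hi
          · omega
          · exact hc i hi (by omega)
      · have : n ∉ D := fun h => by simpa using hD h
        rw [Finset.card_insert_of_notMem this, conjugatePairs_mul hp.ne_zero]
        omega
    · obtain ⟨q, hq'⟩ := p.quadratic_dvd_of_aeval_eq_zero_im_ne_zero hz him
      set b := 2 * z.re
      set d := ‖z‖ ^ 2
      have hm : (X ^ 2 - C b * X + C d : ℝ[X]).Monic := by monicity!
      have hd : (X ^ 2 - C b * X + C d : ℝ[X]).natDegree = 2 := by compute_degree!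
      rw [hq'] at hp hn
      have hq : q.Monic := hm.of_mul_monic_left hp
      rw [hm.natDegree_mul hq, hd] at hn
      obtain ⟨m, rfl⟩ : ∃ m, n = m + 1 := ⟨n - 1, by omega⟩
      obtain ⟨B, a, c, D, hB, hBn, hD, hc, hcard⟩ := ih m (by omega) q hq (by omega)
      -- A quadratic factor appends `X * q` and then `(X - b) * (X * q) + d * q = p`. The nonzero `c
      -- (m + 1) = -d` blocks link `m`, while link `m + 1` is free: one link is lost per conjugate
      -- pair.
      refine ⟨Function.update (Function.update B (m + 1) (X * q)) (m + 2) p,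
        Function.update (Function.update a m 0) (m + 1) b,
        Function.update (Function.update c m 0) (m + 1) (-d),
        insert (m + 1) D, ⟨?_, fun i hi => ?_⟩, by simp, ?_, ?_, ?_⟩
      · simp [hB.zero]
      · rcases Nat.lt_succ_iff_lt_or_eq.1 hi with hi | rfl
        · rcases Nat.lt_succ_iff_lt_or_eq.1 hi with hi | rfl
          · have e1 : i ≠ m + 1 := by omega
            have e2 : i ≠ m + 2 := by omega
            have e3 : i - 1 ≠ m + 1 := by omega
            have e4 : i - 1 ≠ m + 2 := by omega
            simp [e1, e2, e3, e4, hi.ne, hB.succ i hi]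
          · simp [hBn]
        · have e1 : m ≠ m + 2 := by omega
          simp only [add_tsub_cancel_right, Function.update_self,
            Function.update_of_ne (Nat.succ_ne_self (m + 1)).symm, Function.update_of_ne e1,
            Function.update_of_ne (Nat.succ_ne_self m).symm, hBn]
          rw [hq', map_neg]
          ring
      · rw [Finset.insert_subset_iff]
        exact ⟨by simp, hD.trans (Finset.range_mono (by omega))⟩
      · intro i hi hin
        rw [Finset.mem_insert] at hi
        have hi' : i ∈ D := by
          rcases hi with rfl | hi
          · omega
          · exact hi
        have : i < m := by simpa using hD hi'
        rw [Function.update_of_ne (by omega)]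
        by_cases h : i + 1 = m
        · simp [h]
        · rw [Function.update_of_ne h]
          exact hc i hi' (by omega)
      · have : m + 1 ∉ D := fun h => by
          have := hD h
          simp at this
        have h1 : 1 ≤ conjugatePairs (X ^ 2 - C b * X + C d : ℝ[X]) := by
          refine one_le_conjugatePairs hm.ne_zero (z := z) ?_ him
          have h2 : (2 * z.re : ℂ) = z + starRingEnd ℂ z := by
            rw [Complex.add_conj]
            push_cast
            ring
          have h3 : ((‖z‖ : ℂ)) ^ 2 = z * starRingEnd ℂ z := (Complex.mul_conj' z).symm
          simp only [map_add, map_sub, map_mul, map_pow, aeval_X, aeval_C, b, d,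
            Complex.coe_algebraMap, Complex.ofReal_ofNat, h2, h3]
          ring
        rw [Finset.card_insert_of_notMem this, hq', conjugatePairs_mul (hq' ▸ hp.ne_zero)]
        omega

/-! ### The characteristic polynomial after rescaling links. -/

theorem IsThreeTerm.linearIndependent {n : ℕ} {B : ℕ → ℝ[X]} {a c : ℕ → ℝ}
    (hB : IsThreeTerm n B a c) {V : Type*} [AddCommGroup V] [Module ℝ V] {T : Module.End ℝ V}
    {v : V} (hv : IsCyclicVector n T v) :
    LinearIndependent ℝ fun i : Fin n => aeval T (B i) v := by
  -- The powers `X ^ i` for `i ≥ n` are padding: a `Polynomial.Sequence` needs degree `i` at every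
  -- index.
  let S : Polynomial.Sequence ℝ :=
    { elems' := fun i => if i < n then B i else X ^ i
      degree_eq' := fun i => by
        split_ifs with h
        · obtain ⟨h1, h2⟩ := hB.monic_natDegree i h.le
          rw [degree_eq_natDegree h1.ne_zero, h2]
        · simp }
  have hS : ∀ i : Fin n, S i = B i := fun i => if_pos i.2
  rw [Fintype.linearIndependent_iff]
  intro g hg
  have h0 : ∑ i, g i • S (i : ℕ) = 0 := by
    refine hv _ ?_ ?_
    · rw [← mem_degreeLT]
      refine Submodule.sum_mem _ fun i _ => Submodule.smul_mem _ _ ?_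
      rw [mem_degreeLT, S.degree_eq]
      exact_mod_cast i.2
    · rw [← hg]
      simp [hS, LinearMap.sum_apply]
  exact Fintype.linearIndependent_iff.1 (S.linearIndependent.comp _ Fin.val_injective) g h0

theorem IsCyclicVector.charpoly_eq {n : ℕ} {V : Type*} [AddCommGroup V] [Module ℝ V]
    [Module.Finite ℝ V] (hV : Module.finrank ℝ V = n) {T : Module.End ℝ V} {v : V}
    (hv : IsCyclicVector n T v) {P : ℝ[X]} (hP : P.Monic) (hn : P.natDegree = n)
    (h : aeval T P v = 0) : T.charpoly = P := by
  rw [← sub_eq_zero]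
  refine hv _ ?_ ?_
  · have h1 := T.charpoly_monic
    have h2 : T.charpoly.natDegree = n := (LinearMap.charpoly_natDegree T).trans hV
    have h3 : T.charpoly.degree = n := by rw [degree_eq_natDegree h1.ne_zero, h2]
    have h4 : P.degree = n := by rw [degree_eq_natDegree hP.ne_zero, hn]
    calc _ < T.charpoly.degree := degree_sub_lt_left (h3.trans h4.symm) h1.ne_zero
          (by rw [h1.leadingCoeff, hP.leadingCoeff])
      _ = n := h3
  · rw [map_sub, LinearMap.aeval_self_charpoly, h.symm]
    simp [h]

/-- Evaluation at `v` maps the `n`-dimensional space of polynomials of degree less than `n` onto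
`V`, hence is injective. -/
theorem isCyclicVector_of_span {n : ℕ} {V : Type*} [AddCommGroup V] [Module ℝ V]
    [Module.Finite ℝ V] (hV : Module.finrank ℝ V = n) {T : Module.End ℝ V} {v : V}
    (h : ∀ w, ∃ q : ℝ[X], q.degree < n ∧ aeval T q v = w) : IsCyclicVector n T v := by
  let φ : degreeLT ℝ n →ₗ[ℝ] V :=
    ((LinearMap.applyₗ (R := ℝ) v).comp (aeval T).toLinearMap).comp (degreeLT ℝ n).subtype
  have hs : Function.Surjective φ := fun w => by
    obtain ⟨q, hq, h⟩ := h w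
    exact ⟨⟨q, mem_degreeLT.2 hq⟩, h⟩
  have hfin : Module.finrank ℝ (degreeLT ℝ n) = Module.finrank ℝ V := by
    rw [hV, (degreeLTEquiv ℝ n).finrank_eq, Module.finrank_fin_fun]
  have : Module.Finite ℝ (degreeLT ℝ n) := Module.Finite.equiv (degreeLTEquiv ℝ n).symm
  have hi := (LinearMap.injective_iff_surjective_of_finrank_eq_finrank hfin).2 hs
  intro q hq h0
  have : (⟨q, mem_degreeLT.2 hq⟩ : degreeLT ℝ n) = 0 := hi (by rw [map_zero]; exact h0)
  exact congrArg Subtype.val this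

/-- Deforming the links `B i ↦ B (i + 1)` of an operator with cyclic vector `v` by the factors
`1 + α * h i`. -/
theorem IsThreeTerm.exists_deformation {n : ℕ} (hn : 0 < n) {B : ℕ → ℝ[X]} {a c : ℕ → ℝ}
    (hB : IsThreeTerm n B a c) {V : Type*} [AddCommGroup V] [Module ℝ V] [Module.Finite ℝ V]
    (hV : Module.finrank ℝ V = n) {T : Module.End ℝ V} {v : V} (hv : IsCyclicVector n T v)
    {κ : ℝ} (hκ : aeval T (B n) v = κ • v) (h : ℕ → ℝ)
    (hh : ∀ i, i + 1 < n → c (i + 1) * h i = 0) :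
    ∃ H : Module.End ℝ V, ∀ α : ℝ, ∏ i ∈ Finset.range n, (1 + α * h i) ≠ 0 →
      (T + α • H).charpoly = B n - C (κ * ∏ i ∈ Finset.range n, (1 + α * h i)) := by
  set e : ℕ → V := fun i => aeval T (B i) v with he
  have hli : LinearIndependent ℝ fun i : Fin n => e i := hB.linearIndependent hv
  let b : Module.Basis (Fin n) ℝ V := by
    have : Nonempty (Fin n) := ⟨⟨0, hn⟩⟩
    exact basisOfLinearIndependentOfCardEqFinrank hli (by simp [hV])
  have hb : ∀ i : Fin n, b i = e i := fun i => by
    simp [b]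
  -- For `i = n - 1` the target is `e n = κ • v`, so the closing link is rescaled as well.
  let H : Module.End ℝ V := b.constr ℝ fun i : Fin n => h i • e (i + 1)
  have hH : ∀ i < n, H (e i) = h i • e (i + 1) := fun i hi => by
    have := b.constr_basis ℝ (fun i : Fin n => h i • e (i + 1)) ⟨i, hi⟩
    rwa [hb] at this
  have e0 : e 0 = v := by simp [he, hB.zero]
  have hT : ∀ i < n, e (i + 1) = T (e i) - a i • e i - c i • e (i - 1) := fun i hi => by
    simp [he, hB.succ i hi, Algebra.algebraMap_eq_smul_one]
  refine ⟨H, fun α hα => ?_⟩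
  set W : ℕ → ℝ := fun j => ∏ i ∈ Finset.range j, (1 + α * h i) with hW
  have hWs : ∀ i, W (i + 1) = W i * (1 + α * h i) := fun i => Finset.prod_range_succ _ _
  -- The deformed operator runs through the same vectors, each scaled by the factors of the links
  -- already crossed.
  have key : ∀ i ≤ n, aeval (T + α • H) (B i) v = W i • e i := by
    intro i
    induction i using Nat.strong_induction_on with
    | _ i ih =>
      intro hi
      rcases i with _ | i
      · simp [hB.zero, e0, hW]
      · have h1 := ih i (by omega) (by omega)
        have h2 := ih (i - 1) (by omega) (by omega)
        -- The backward term survives because a link under a nonzero `c i` is not rescaled. At `i =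
        -- 0`, `i - 1` is again `0`.
        have hc : c i * W i = c i * W (i - 1) := by
          rcases i with _ | i
          · rfl
          · rw [hWs, Nat.add_sub_cancel]
            linear_combination α * W i * hh i (by omega)
        have h3 : aeval (T + α • H) (B (i + 1)) v
            = W i • (T (e i) + α • h i • e (i + 1)) - a i • W i • e i
              - c i • W (i - 1) • e (i - 1) := by
          simp only [hB.succ i (by omega), map_sub, map_mul, aeval_X, aeval_C,
            Algebra.algebraMap_eq_smul_one, LinearMap.sub_apply, Module.End.mul_apply, h1, h2,
            LinearMap.smul_apply, Module.End.one_apply, LinearMap.add_apply, map_smul,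
            hH i (by omega)]
          module
        rw [h3, hWs, smul_smul (c i), ← hc, show T (e i) = e (i + 1) + a i • e i + c i • e (i - 1)
          by rw [hT i (by omega)]; abel]
        module
  have hWn : ∀ i ≤ n, W i ≠ 0 := fun i hi h0 => hα <| by
    obtain ⟨j, hj, h0⟩ := Finset.prod_eq_zero_iff.1 h0
    exact Finset.prod_eq_zero (Finset.range_mono hi hj) h0
  -- All `W i` are nonzero, so by `key` the vectors `B i (T + α H) v` still span.
  have hcyc : IsCyclicVector n (T + α • H) v := by
    refine isCyclicVector_of_span hV fun w => ⟨∑ i : Fin n, C (b.repr w i / W i) * B i, ?_, ?_⟩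
    · rw [← mem_degreeLT]
      refine Submodule.sum_mem _ fun i _ => ?_
      rw [← smul_eq_C_mul]
      refine Submodule.smul_mem _ _ ?_
      obtain ⟨h1, h2⟩ := hB.monic_natDegree i i.2.le
      rw [mem_degreeLT, degree_eq_natDegree h1.ne_zero, h2]
      exact_mod_cast i.2
    · conv_rhs => rw [← b.sum_repr w]
      rw [map_sum, LinearMap.sum_apply]
      refine Finset.sum_congr rfl fun i _ => ?_
      simp only [map_mul, aeval_C, Algebra.algebraMap_eq_smul_one, Module.End.mul_apply,
        key i i.2.le, LinearMap.smul_apply, Module.End.one_apply, hb, smul_smul]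
      rw [div_mul_cancel₀ _ (hWn i i.2.le)]
  obtain ⟨h1, h2⟩ := hB.monic_natDegree n le_rfl
  have hdeg : (C (κ * W n)).degree < (B n).degree := by
    rw [degree_eq_natDegree h1.ne_zero, h2]
    exact lt_of_le_of_lt degree_C_le (by exact_mod_cast hn)
  refine hcyc.charpoly_eq hV (h1.sub_of_left hdeg) ?_ ?_
  · rw [natDegree_sub_C, h2]
  · have hκ' : e n = κ • v := hκ
    simp only [map_sub, aeval_C, Algebra.algebraMap_eq_smul_one, LinearMap.sub_apply,
      key n le_rfl, hκ', LinearMap.smul_apply, Module.End.one_apply]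
    module

theorem IsThreeTerm.exists_matrix_deformation {n : ℕ} (hn : 0 < n) {B : ℕ → ℝ[X]} {a c : ℕ → ℝ}
    (hB : IsThreeTerm n B a c) {F : Matrix (Fin n) (Fin n) ℝ}
    (hF : OneJordanBlockPerEigenvalue F) {β : ℝ} (hβ : F.charpoly = B n + C β) (h : ℕ → ℝ)
    (hh : ∀ i, i + 1 < n → c (i + 1) * h i = 0) :
    ∃ H : Matrix (Fin n) (Fin n) ℝ, ∀ α : ℝ,
      (F + α • H).charpoly = B n + C (β * ∏ i ∈ Finset.range n, (1 + α * h i)) := by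
  obtain ⟨v, hv⟩ := hF.exists_isCyclicVector
  -- By Cayley–Hamilton, `B n (F) = -β`.
  have hκ : aeval (Matrix.toLin' F) (B n) v = (-β) • v := by
    have h1 := (Matrix.toLin' F).aeval_self_charpoly
    rw [Matrix.charpoly_toLin', hβ, map_add, aeval_C, Algebra.algebraMap_eq_smul_one] at h1
    rw [eq_neg_of_add_eq_zero_left h1]
    simp
  obtain ⟨H, hH⟩ := hB.exists_deformation hn (Module.finrank_fin_fun ℝ) hv hκ h hh
  refine ⟨LinearMap.toMatrix' H, fun α => Polynomial.funext fun x => ?_⟩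
  -- At the finitely many `α` where the product vanishes `v` may fail to be cyclic; both sides are
  -- continuous in `α`, so the identity extends from the dense complement.
  have hfin : {α : ℝ | ∏ i ∈ Finset.range n, (1 + α * h i) = 0}.Finite := by
    have h0 : (∏ i ∈ Finset.range n, (1 + X * C (h i)) : ℝ[X]) ≠ 0 := fun h0 => by
      have := congrArg (eval 0) h0
      simp [eval_prod] at this
    refine (finite_setOfPred_isRoot h0).subset fun α hα => ?_
    have hα : ∏ i ∈ Finset.range n, (1 + α * h i) = 0 := hα
    change eval α _ = 0
    rw [eval_prod, ← hα]
    exact Finset.prod_congr rfl fun i _ => by rw [eval_add, eval_mul, eval_X, eval_C, eval_one]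
  have hd : Dense {α : ℝ | ∏ i ∈ Finset.range n, (1 + α * h i) = 0}ᶜ :=
    hfin.countable.dense_compl ℝ
  refine congrFun (Continuous.ext_on (f := fun α : ℝ => eval x (F + α •
    LinearMap.toMatrix' H).charpoly) hd ?_ (g := fun α : ℝ => eval x (B n + C (β * ∏ i ∈
      Finset.range n, (1 + α * h i)))) ?_ fun α hα => ?_) α
  · simp only [Matrix.eval_charpoly]
    refine Continuous.matrix_det ?_
    fun_prop
  · simp only [eval_add, eval_C]
    fun_prop
  · have h1 := hH α hα
    have h2 : Matrix.toLin' F + α • H = Matrix.toLin' (F + α • LinearMap.toMatrix' H) := by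
      simp
    rw [h2, Matrix.charpoly_toLin'] at h1
    simp only [h1]
    simp

/-! ### Stability as the constant term varies: convexity and boundedness. -/

theorem matrixStable_iff_polyStable_charpoly {n : ℕ} (A : Matrix (Fin n) (Fin n) ℝ) :
    MatrixStable A ↔ PolyStable A.charpoly := by
  refine forall_congr' fun z => ?_
  rw [Matrix.mem_spectrum_iff_isRoot_charpoly, IsRoot, Matrix.charpoly_map, eval_map_algebraMap]

theorem Polynomial.Monic.aeval_eq_prod_aroots {p : ℝ[X]} (hp : p.Monic) (s : ℂ) :
    aeval s p = ((p.aroots ℂ).map fun z => s - z).prod := by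
  have h := (IsAlgClosed.splits (p.map (algebraMap ℝ ℂ))).eq_prod_roots_of_monic
    (hp.map (algebraMap ℝ ℂ))
  rw [← eval_map_algebraMap, h, eval_multiset_prod, Multiset.map_map]
  simp [aroots]

theorem PolyStable.exists_margin {p : ℝ[X]} (hp0 : p ≠ 0) (hp : PolyStable p) :
    ∃ δ > 0, ∀ z : ℂ, aeval z p = 0 → z.re < -δ := by
  classical
  have h : ∀ s : Multiset ℂ, (∀ z ∈ s, z.re < 0) → ∃ δ > 0, ∀ z ∈ s, z.re < -δ := by
    intro s
    induction s using Multiset.induction_on with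
    | empty => exact fun _ => ⟨1, one_pos, by simp⟩
    | cons a s ih =>
      intro h
      obtain ⟨δ, hδ, h'⟩ := ih fun z hz => h z (Multiset.mem_cons_of_mem hz)
      have ha := h a (Multiset.mem_cons_self a s)
      refine ⟨min δ (-a.re / 2), lt_min hδ (by linarith), fun z hz => ?_⟩
      have h1 := min_le_left δ (-a.re / 2)
      have h2 := min_le_right δ (-a.re / 2)
      rcases Multiset.mem_cons.1 hz with rfl | hz
      · linarith
      · linarith [h' z hz]
  obtain ⟨δ, hδ, h⟩ := h (p.aroots ℂ) fun z hz => hp z (mem_aroots.1 hz).2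
  exact ⟨δ, hδ, fun z hz => h z (mem_aroots.2 ⟨hp0, hz⟩)⟩

theorem Multiset.prod_map_lt_prod_map_of_nonneg {ι : Type*} {s : Multiset ι} (hs : s ≠ 0)
    (f g : ι → ℝ) (hf : ∀ i ∈ s, 0 ≤ f i) (h : ∀ i ∈ s, f i < g i) :
    (s.map f).prod < (s.map g).prod := by
  induction s using Multiset.induction_on with
  | empty => exact absurd rfl hs
  | cons a s ih =>
    rw [Multiset.map_cons, Multiset.map_cons, Multiset.prod_cons, Multiset.prod_cons]
    have hfa := hf a (Multiset.mem_cons_self a s)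
    have hga := h a (Multiset.mem_cons_self a s)
    by_cases hs : s = 0
    · simpa [hs] using hga
    · refine mul_lt_mul'' hga (ih hs (fun i hi => hf i (Multiset.mem_cons_of_mem hi))
        fun i hi => h i (Multiset.mem_cons_of_mem hi)) hfa (Multiset.prod_nonneg fun x hx => ?_)
      obtain ⟨i, hi, rfl⟩ := Multiset.mem_map.1 hx
      exact hf i (Multiset.mem_cons_of_mem hi)

/-- A polynomial with all roots to the left of a vertical line is smaller at the mirror image of
a point to the right of the line. -/
theorem norm_aeval_reflect_lt {p : ℝ[X]} (hp : p.Monic) (hd : p.natDegree ≠ 0) {δ : ℝ}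
    (h : ∀ z : ℂ, aeval z p = 0 → z.re < -δ) {s : ℂ} (hs : -δ < s.re) :
    ‖aeval (-2 * δ - s) p‖ < ‖aeval s p‖ := by
  -- The true mirror image of `s` in the line is `-2δ - conj s`; for a real polynomial the conjugate
  -- point gives the same norm.
  have hconj : ‖aeval (-2 * δ - s) p‖ = ‖aeval (-2 * δ - starRingEnd ℂ s) p‖ := by
    rw [← RCLike.norm_conj, ← aeval_conj]
    congr 2
    simp [Complex.conj_ofNat]
  have hprod : ∀ f : ℂ → ℂ, ‖((p.aroots ℂ).map f).prod‖ = ((p.aroots ℂ).map fun z => ‖f z‖).prod :=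
    fun f => (map_multiset_prod (normHom (α := ℂ)) _).trans (by rw [Multiset.map_map]; rfl)
  rw [hconj, hp.aeval_eq_prod_aroots, hp.aeval_eq_prod_aroots, hprod, hprod]
  have hlt : ∀ z ∈ p.aroots ℂ, ‖-2 * (δ : ℂ) - starRingEnd ℂ s - z‖ < ‖s - z‖ := by
    intro z hz
    have hz := h z (mem_aroots.1 hz).2
    refine lt_of_pow_lt_pow_left₀ 2 (norm_nonneg _) ?_
    rw [← Complex.normSq_eq_norm_sq, ← Complex.normSq_eq_norm_sq, Complex.normSq_apply,
      Complex.normSq_apply]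
    simp
    nlinarith
  refine Multiset.prod_map_lt_prod_map_of_nonneg ?_ _ _ (fun z _ => norm_nonneg _) hlt
  rw [aroots, ← Multiset.card_pos,
    ← (IsAlgClosed.splits (p.map (algebraMap ℝ ℂ))).natDegree_eq_card_roots, natDegree_map]
  exact Nat.pos_of_ne_zero hd

/-- At a root `s` of `p + t d` with `Re s ≥ 0`, `p` and `p + d` have absolute values `t|d|` and `(1
- t)|d|`. At the reflected point both are strictly smaller, so two numbers differing by `d` would
have absolute values with sum below `|d|`. The margin `δ > 0` keeps the inequalities strict for `s`
on the imaginary axis. -/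
theorem PolyStable.convex_add_C {p : ℝ[X]} (hp : p.Monic) (hd : p.natDegree ≠ 0) {d t : ℝ}
    (h0 : PolyStable p) (h1 : PolyStable (p + C d)) (ht0 : 0 ≤ t) (ht1 : t ≤ 1) :
    PolyStable (p + C (t * d)) := by
  have hdeg : (C d).degree < p.degree := by
    refine lt_of_le_of_lt degree_C_le ?_
    rw [degree_eq_natDegree hp.ne_zero]
    exact_mod_cast Nat.pos_of_ne_zero hd
  have hp1 : (p + C d).Monic := hp.add_of_left hdeg
  have hd1 : (p + C d).natDegree ≠ 0 := by rwa [natDegree_add_C]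
  obtain ⟨δ₁, hδ₁, hz₁⟩ := h0.exists_margin hp.ne_zero
  obtain ⟨δ₂, hδ₂, hz₂⟩ := h1.exists_margin hp1.ne_zero
  obtain ⟨δ, hδ, hl1, hl2⟩ : ∃ δ > 0, δ ≤ δ₁ ∧ δ ≤ δ₂ :=
    ⟨min δ₁ δ₂, lt_min hδ₁ hδ₂, min_le_left _ _, min_le_right _ _⟩
  intro s hs
  by_contra! hre
  have e0 := norm_aeval_reflect_lt hp hd (δ := δ) (fun z hz => by linarith [hz₁ z hz])
    (s := s) (by linarith)
  have e1 := norm_aeval_reflect_lt hp1 hd1 (δ := δ) (fun z hz => by linarith [hz₂ z hz])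
    (s := s) (by linarith)
  simp only [map_add, aeval_C, Complex.coe_algebraMap] at hs e1
  generalize aeval s p = u at *
  generalize aeval (-2 * (δ : ℂ) - s) p = w at *
  replace e0 := pow_lt_pow_left₀ e0 (norm_nonneg _) two_ne_zero
  replace e1 := pow_lt_pow_left₀ e1 (norm_nonneg _) two_ne_zero
  rw [← Complex.normSq_eq_norm_sq, ← Complex.normSq_eq_norm_sq, Complex.normSq_apply,
    Complex.normSq_apply] at e0 e1
  have hr := congrArg Complex.re hs
  have hi := congrArg Complex.im hs
  simp at hr hi e1
  have hr' : u.re = -(t * d) := by linarith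
  rw [hr', hi] at e0 e1
  rcases ht0.eq_or_lt with rfl | ht0
  · nlinarith [sq_nonneg w.re, sq_nonneg w.im]
  -- The triangle inequality in squared form: `t|w + d|² + (1 - t)|w|² = |w + t d|² + t(1 - t)d²`.
  · have e2 := mul_lt_mul_of_pos_left e1 ht0
    have e3 := mul_le_mul_of_nonneg_left e0.le (sub_nonneg.2 ht1)
    nlinarith [sq_nonneg (w.re + t * d), sq_nonneg w.im]

theorem ordConnected_setOf_polyStable {p : ℝ[X]} (hp : p.Monic) (hd : p.natDegree ≠ 0) (β : ℝ) :
    {t : ℝ | PolyStable (p + C (β * t))}.OrdConnected := by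
  refine Set.ordConnected_of_Ioo fun x hx y hy hxy t ht => ?_
  have hdeg : (C (β * x)).degree < p.degree := by
    refine lt_of_le_of_lt degree_C_le ?_
    rw [degree_eq_natDegree hp.ne_zero]
    exact_mod_cast Nat.pos_of_ne_zero hd
  have hxy' : y - x ≠ 0 := by linarith
  have := PolyStable.convex_add_C (d := β * (y - x)) (t := (t - x) / (y - x))
    (hp.add_of_left hdeg) (by rwa [natDegree_add_C]) hx ?_ ?_ ?_
  · rw [add_assoc, ← C_add] at this
    rw [Set.mem_ofPred_eq, show β * t = β * x + (t - x) / (y - x) * (β * (y - x)) by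
      field_simp
      ring]
    exact this
  · rw [add_assoc, ← C_add]
    rw [show β * x + β * (y - x) = β * y by ring]
    exact hy
  · exact div_nonneg (by linarith [ht.1]) (by linarith)
  · exact (div_le_one (by linarith)).2 (by linarith [ht.2])

theorem Multiset.sum_sq_eq {R : Type*} [CommRing R] (s : Multiset R) :
    (s.map fun x => x ^ 2).sum = s.esymm 1 ^ 2 - 2 * s.esymm 2 := by
  induction s using Multiset.induction_on with
  | empty => simp [Multiset.esymm, Multiset.powersetCard_zero_right]
  | cons a s ih =>
    have h1 : (a ::ₘ s).esymm 1 = a + s.esymm 1 := by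
      simp [Multiset.esymm, Multiset.powersetCard_one, add_comm]
    have h2 : (a ::ₘ s).esymm 2 = s.esymm 2 + a * s.esymm 1 := by
      simp [Multiset.esymm, Multiset.powersetCard_one, Multiset.powersetCard_cons]
      exact Multiset.sum_map_mul_left.trans (by rw [Multiset.map_id'])
    rw [Multiset.map_cons, Multiset.sum_cons, ih, h1, h2]
    ring

/-- The constant terms of the stable polynomials with prescribed higher coefficients are bounded
when the degree is at least three. -/
theorem exists_bound_of_polyStable {p : ℝ[X]} (hp : p.Monic) (hd : 3 ≤ p.natDegree) :
    ∃ K : ℝ, ∀ d : ℝ, PolyStable (p + C d) → |d| ≤ K := by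
  set n := p.natDegree with hn
  set b := p.coeff (n - 1) with hb
  set e := p.coeff (n - 2) with he
  -- In degree at least three, the first two symmetric functions of the roots do not involve the
  -- constant term. The sum bounds the real parts, as they all have one sign; the sum of squares
  -- then bounds the imaginary parts. This gives `‖z‖ ^ 2 ≤ L`, and the summand `1` makes `L ≥ 1`,
  -- so that `‖z‖ ≤ L`.
  set L : ℝ := 2 * (n * b ^ 2) + |b ^ 2 - 2 * e| + 1 with hL
  refine ⟨L ^ n + |p.coeff 0|, fun d h => ?_⟩
  set q := p + C d with hq
  have hdeg : (C d).degree < p.degree := by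
    refine lt_of_le_of_lt degree_C_le ?_
    rw [degree_eq_natDegree hp.ne_zero]
    exact_mod_cast (by omega : 0 < p.natDegree)
  have hqm : q.Monic := hp.add_of_left hdeg
  have hqn : q.natDegree = n := by rw [hq, natDegree_add_C]
  have hsplit := IsAlgClosed.splits (q.map (algebraMap ℝ ℂ))
  have hcard : Multiset.card (q.aroots ℂ) = n := by
    rw [aroots, ← hsplit.natDegree_eq_card_roots, natDegree_map, hqn]
  have hcoeff : ∀ j, j ≤ n → ((q.coeff (n - j) : ℝ) : ℂ) = (-1) ^ j * (q.aroots ℂ).esymm j := by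
    intro j hj
    have := coeff_eq_esymm_roots_of_splits hsplit (k := n - j) (by rw [natDegree_map]; omega)
    rw [(hqm.map _).leadingCoeff, coeff_map, natDegree_map, hqn, Nat.sub_sub_self hj] at this
    simpa using this
  have hc1 : q.coeff (n - 1) = b := by
    rw [hq, coeff_add, coeff_C, if_neg (by omega), add_zero]
  have hc2 : q.coeff (n - 2) = e := by
    rw [hq, coeff_add, coeff_C, if_neg (by omega), add_zero]
  have h1 : (q.aroots ℂ).esymm 1 = -b := by
    have := hcoeff 1 (by omega)
    rw [hc1] at this
    rw [this]; ring
  have h2 : (q.aroots ℂ).esymm 2 = e := by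
    have := hcoeff 2 (by omega)
    rw [hc2] at this
    rw [this]; ring
  have h3 := Multiset.sum_sq_eq (q.aroots ℂ)
  rw [h1, h2] at h3
  have hre0 : ∀ z ∈ q.aroots ℂ, z.re < 0 := fun z hz => h z (mem_aroots.1 hz).2
  have hsum_re : ((q.aroots ℂ).map fun z => -z.re).sum = b := by
    have h4 : (q.aroots ℂ).esymm 1 = (q.aroots ℂ).sum := by
      simp [Multiset.esymm, Multiset.powersetCard_one]
    have h5 := congrArg (-Complex.reLm) (h4.symm.trans h1)
    rw [map_multiset_sum] at h5
    simpa using h5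
  have hsum_sq : ((q.aroots ℂ).map fun z => z.re ^ 2 - z.im ^ 2).sum = b ^ 2 - 2 * e := by
    have h5 := congrArg Complex.reLm h3
    rw [map_multiset_sum, Multiset.map_map] at h5
    have h6 : ∀ z : ℂ, Complex.reLm (z ^ 2) = z.re ^ 2 - z.im ^ 2 := fun z => by
      simp [sq]
    simp only [Function.comp_def, h6] at h5
    rw [h5, ← Complex.ofReal_neg, ← Complex.ofReal_pow]
    simp [sq]
  have hre : ∀ z ∈ q.aroots ℂ, z.re ^ 2 ≤ b ^ 2 := by
    intro z hz
    have : -z.re ≤ b := by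
      rw [← hsum_re]
      refine Multiset.single_le_sum ?_ _ (Multiset.mem_map_of_mem _ hz)
      intro x hx
      obtain ⟨w, hw, rfl⟩ := Multiset.mem_map.1 hx
      linarith [hre0 w hw]
    nlinarith [hre0 z hz]
  have hsum_re2 : ((q.aroots ℂ).map fun z => z.re ^ 2).sum ≤ n * b ^ 2 := by
    have := Multiset.sum_le_card_nsmul ((q.aroots ℂ).map fun z => z.re ^ 2) (b ^ 2) (by
      intro x hx
      obtain ⟨w, hw, rfl⟩ := Multiset.mem_map.1 hx
      exact hre w hw)
    simpa [hcard] using this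
  have hnorm : ∀ z ∈ q.aroots ℂ, ‖z‖ ≤ L := by
    intro z hz
    have h4 : z.im ^ 2 ≤ ((q.aroots ℂ).map fun z => z.im ^ 2).sum := by
      refine Multiset.single_le_sum ?_ _ (Multiset.mem_map_of_mem (fun z : ℂ => z.im ^ 2) hz)
      intro x hx
      obtain ⟨w, hw, rfl⟩ := Multiset.mem_map.1 hx
      positivity
    have h5 : z.re ^ 2 ≤ ((q.aroots ℂ).map fun z => z.re ^ 2).sum := by
      refine Multiset.single_le_sum ?_ _ (Multiset.mem_map_of_mem (fun z : ℂ => z.re ^ 2) hz)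
      intro x hx
      obtain ⟨w, hw, rfl⟩ := Multiset.mem_map.1 hx
      positivity
    rw [Multiset.sum_map_sub] at hsum_sq
    have h6 : ‖z‖ ^ 2 = z.re ^ 2 + z.im ^ 2 := by
      rw [← Complex.normSq_eq_norm_sq, Complex.normSq_apply]; ring
    have h7 := neg_abs_le (b ^ 2 - 2 * e)
    have h8 : 1 ≤ L := by
      have : 0 ≤ 2 * (n * b ^ 2) + |b ^ 2 - 2 * e| := by positivity
      linarith
    have h9 : ‖z‖ ^ 2 ≤ L := by rw [h6, hL]; linarith
    nlinarith [norm_nonneg z]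
  have hprod : ‖(q.aroots ℂ).prod‖ ≤ L ^ n := by
    rw [show ‖(q.aroots ℂ).prod‖ = ((q.aroots ℂ).map fun z => ‖z‖).prod from
      map_multiset_prod (normHom (α := ℂ)) _]
    have := Multiset.prod_map_le_prod_map₀ (fun z : ℂ => ‖z‖) (fun _ => L)
      (fun z _ => norm_nonneg z) hnorm
    rwa [Multiset.map_const', Multiset.prod_replicate, hcard] at this
  have h0 : |q.coeff 0| ≤ L ^ n := by
    have := hcoeff n le_rfl
    rw [Nat.sub_self] at this
    have h10 : (q.aroots ℂ).esymm n = (q.aroots ℂ).prod := by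
      rw [← hcard]; simp [Multiset.esymm]
    rw [← Real.norm_eq_abs, ← Complex.norm_real, this, norm_mul, norm_pow, norm_neg, norm_one, one_pow, one_mul, h10]
    exact hprod
  have h11 : q.coeff 0 = p.coeff 0 + d := by simp [hq]
  calc |d| = |q.coeff 0 - p.coeff 0| := by rw [h11]; ring_nf
    _ ≤ |q.coeff 0| + |p.coeff 0| := abs_sub _ _
    _ ≤ _ := by gcongr

/-! ### Counting the components of the preimage of an interval. -/

/-- A continuous index into a discrete space factors through the components; convexity of its fibres
makes the induced map injective. -/
theorem numComponents_eq_of_index {S : Set ℝ} {k : ℕ} (φ : ℝ → ℕ) (hφ : ContinuousOn φ S)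
    (hlt : ∀ α ∈ S, φ α < k) (hsurj : ∀ j < k, ∃ α ∈ S, φ α = j)
    (hconn : ∀ α ∈ S, ∀ β ∈ S, φ α = φ β → α ≤ β → Set.Icc α β ⊆ S) :
    numComponents S = k := by
  have hf : Continuous fun x : S => φ x := continuousOn_iff_continuous_domRestrict.1 hφ
  let g : ConnectedComponents S → ℕ := hf.connectedComponentsLift
  have hg : ∀ x : S, g x = φ x := fun x => hf.connectedComponentsLift_apply_coe x
  have hinj' : ∀ x y : S, φ x = φ y → (x : ℝ) ≤ y →
      (x : ConnectedComponents S) = (y : ConnectedComponents S) := by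
    intro x y h hxy
    have hsub := hconn x x.2 y y.2 h hxy
    have hpre : IsPreconnected (Subtype.val ⁻¹' Set.Icc (x : ℝ) y : Set S) := by
      rw [← Topology.IsInducing.subtypeVal.isPreconnected_image, Subtype.image_preimage_coe,
        Set.inter_eq_right.2 hsub]
      exact isPreconnected_Icc
    rw [eq_comm, ConnectedComponents.coe_eq_coe']
    exact hpre.subset_connectedComponent (x := x) ⟨le_rfl, hxy⟩ ⟨hxy, le_rfl⟩
  have hinj : Function.Injective g := by
    intro x y h
    obtain ⟨x, rfl⟩ := ConnectedComponents.surjective_coe x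
    obtain ⟨y, rfl⟩ := ConnectedComponents.surjective_coe y
    rw [hg, hg] at h
    rcases le_total (x : ℝ) y with hxy | hxy
    · exact hinj' x y h hxy
    · exact (hinj' y x h.symm hxy).symm
  have hrange : Set.range g = Set.Iio k := by
    ext j
    constructor
    · rintro ⟨x, rfl⟩
      obtain ⟨x, rfl⟩ := ConnectedComponents.surjective_coe x
      rw [hg]
      exact hlt x x.2
    · intro hj
      obtain ⟨α, hα, rfl⟩ := hsurj j hj
      exact ⟨((⟨α, hα⟩ : S) : ConnectedComponents S), hg _⟩
  rw [numComponents, Nat.card_congr (Equiv.ofInjective g hinj), hrange]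
  simp

theorem Set.OrdConnected.mem_of_abs_le {T : Set ℝ} (hT : T.OrdConnected) (h0 : (0 : ℝ) ∈ T)
    {a b : ℝ} (hb : b ∈ T) (hab : 0 ≤ a * b) (h : |a| ≤ |b|) : a ∈ T := by
  rcases le_total 0 b with hb0 | hb0
  · rcases le_or_gt 0 a with ha | ha
    · exact hT.out h0 hb ⟨ha, by rwa [abs_of_nonneg ha, abs_of_nonneg hb0] at h⟩
    · have : b = 0 := by nlinarith
      simp [this] at h
      rwa [h]
  · rcases le_or_gt a 0 with ha | ha
    · exact hT.out hb h0 ⟨by rw [abs_of_nonpos ha, abs_of_nonpos hb0] at h; linarith, ha⟩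
    · have : b = 0 := by nlinarith
      simp [this] at h
      rwa [h]

/-- Log-concavity of a product of affine functions where none changes sign: weighted AM-GM on each
factor. -/
theorem min_abs_prod_le_abs_prod {ι : Type*} (s : Finset ι) (u v : ι → ℝ)
    (huv : ∀ i ∈ s, 0 < u i * v i) {w₁ w₂ : ℝ} (h₁ : 0 ≤ w₁) (h₂ : 0 ≤ w₂) (hw : w₁ + w₂ = 1) :
    min |∏ i ∈ s, u i| |∏ i ∈ s, v i| ≤ |∏ i ∈ s, (w₁ * u i + w₂ * v i)| := by
  have habs : ∀ i ∈ s, |w₁ * u i + w₂ * v i| = w₁ * |u i| + w₂ * |v i| := by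
    intro i hi
    rcases pos_and_pos_or_neg_and_neg_of_mul_pos (huv i hi) with ⟨hu, hv⟩ | ⟨hu, hv⟩
    · rw [abs_of_pos hu, abs_of_pos hv, abs_of_nonneg (by positivity)]
    · rw [abs_of_neg hu, abs_of_neg hv, abs_of_nonpos (by nlinarith)]
      ring
  have hge : |∏ i ∈ s, u i| ^ w₁ * |∏ i ∈ s, v i| ^ w₂ ≤ |∏ i ∈ s, (w₁ * u i + w₂ * v i)| := by
    rw [Finset.abs_prod, Finset.abs_prod, Finset.abs_prod,
      ← Real.finsetProd_rpow _ _ (fun i _ => abs_nonneg _),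
      ← Real.finsetProd_rpow _ _ (fun i _ => abs_nonneg _), ← Finset.prod_mul_distrib]
    refine Finset.prod_le_prod (fun i _ => by positivity) fun i hi => ?_
    rw [habs i hi]
    exact Real.geom_mean_le_arith_mean2_weighted h₁ h₂ (abs_nonneg _) (abs_nonneg _) hw
  refine le_trans ?_ hge
  set μ := min |∏ i ∈ s, u i| |∏ i ∈ s, v i| with hμ
  have hμ0 : 0 ≤ μ := le_min (abs_nonneg _) (abs_nonneg _)
  calc μ = μ ^ w₁ * μ ^ w₂ := by
        rw [← Real.rpow_add_of_nonneg hμ0 h₁ h₂, hw, Real.rpow_one]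
    _ ≤ _ := by
        have := min_le_left |∏ i ∈ s, u i| |∏ i ∈ s, v i|
        have := min_le_right |∏ i ∈ s, u i| |∏ i ∈ s, v i|
        gcongr

section
variable {T : Set ℝ} {m : ℕ} {q y : ℕ → ℝ}

/-- The polynomial with value `1` at `0` and roots `-q 0, …, -q m`. -/
noncomputable def rootProd (q : ℕ → ℝ) (m : ℕ) (α : ℝ) : ℝ :=
  ∏ j ∈ Finset.range (m + 1), (1 + α / q j)

theorem rootProd_mul_pos {α β : ℝ}
    (h : ∀ j < m + 1, 0 < (1 + α / q j) * (1 + β / q j)) :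
    0 < rootProd q m α * rootProd q m β := by
  rw [rootProd, rootProd, ← Finset.prod_mul_distrib]
  exact Finset.prod_pos fun j hj => h j (Finset.mem_range.1 hj)

/-- By log-concavity `|rootProd|` at `β` is at least its minimum over the ends `γ`, `z`. It cannot
dominate the value at `z`, or that value would lie between `0` and a point of `T`; so it dominates
the value at `γ`. -/
theorem rootProd_mem_of_between (hT : T.OrdConnected) (h0 : (0 : ℝ) ∈ T) {γ β z : ℝ}
    (hβ : rootProd q m β ∈ T) (hz : rootProd q m z ∉ T) (hs : β ∈ segment ℝ γ z)
    (h : ∀ j < m + 1, 0 < (1 + γ / q j) * (1 + z / q j)) : rootProd q m γ ∈ T := by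
  obtain ⟨w₁, w₂, h₁, h₂, hw, rfl⟩ := hs
  have e : ∀ j, 1 + (w₁ • γ + w₂ • z) / q j = w₁ * (1 + γ / q j) + w₂ * (1 + z / q j) := by
    intro j
    rw [smul_eq_mul, smul_eq_mul]
    linear_combination (-1 : ℝ) * hw
  have hγβ : ∀ j < m + 1, 0 < (1 + γ / q j) * (1 + (w₁ • γ + w₂ • z) / q j) := by
    intro j hj
    rw [e, mul_add, mul_left_comm, mul_left_comm _ w₂]
    have hj := h j hj
    have h3 : 0 < (1 + γ / q j) * (1 + γ / q j) := by
      have : (1 + γ / q j) ≠ 0 := fun h0 => by simp [h0] at hj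
      exact mul_self_pos.2 this
    rcases h₁.eq_or_lt with h4 | h4
    · have : w₂ = 1 := by linarith
      rw [← h4, this]
      linarith
    · have := mul_pos h4 h3
      have := mul_nonneg h₂ hj.le
      linarith
  have hmin := min_abs_prod_le_abs_prod (Finset.range (m + 1)) (fun j => 1 + γ / q j)
    (fun j => 1 + z / q j) (fun j hj => h j (Finset.mem_range.1 hj)) h₁ h₂ hw
  simp only [← e] at hmin
  change min |rootProd q m γ| |rootProd q m z| ≤ |rootProd q m (w₁ • γ + w₂ • z)| at hmin
  have p1 := rootProd_mul_pos hγβ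
  have p2 := rootProd_mul_pos h
  rcases min_le_iff.1 hmin with hle | hle
  · exact hT.mem_of_abs_le h0 hβ p1.le hle
  · refine absurd (hT.mem_of_abs_le h0 hβ ?_ hle) hz
    by_contra! hneg
    have h3 : 0 < rootProd q m γ ^ 2 := by
      have : rootProd q m γ ≠ 0 := fun h0 => by simp [h0] at p1
      positivity
    nlinarith [mul_pos p1 p2]

theorem rootProd_mem_of_abs_le (hT : T.OrdConnected) (h0 : (0 : ℝ) ∈ T) {γ β : ℝ}
    (hβ : rootProd q m β ∈ T) (hs : ∀ j < m + 1, 0 < (1 + γ / q j) * (1 + β / q j))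
    (h : ∀ j < m + 1, |1 + γ / q j| ≤ |1 + β / q j|) : rootProd q m γ ∈ T := by
  refine hT.mem_of_abs_le h0 hβ (rootProd_mul_pos hs).le ?_
  rw [rootProd, rootProd, Finset.abs_prod, Finset.abs_prod]
  exact Finset.prod_le_prod (fun i _ => abs_nonneg _) fun j hj => h j (Finset.mem_range.1 hj)

theorem one_add_div_pos {α q : ℝ} (hq : 0 < q) (h : -q < α) : 0 < 1 + α / q := by
  rw [one_add_div hq.ne']
  exact div_pos (by linarith) hq

theorem one_add_div_neg {α q : ℝ} (hq : 0 < q) (h : α < -q) : 1 + α / q < 0 := by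
  rw [one_add_div hq.ne']
  exact div_neg_of_neg_of_pos (by linarith) hq

/-- Here `-q p` is the only root between the separators `-y p` and `-y (p - 1)`. A point left of it
is compared with `α` and `-y p`, one right of it with `β` and `-y (p - 1)`. In the two outermost
regions a separator is missing, but there `|rootProd|` is monotone. -/
theorem rootProd_mem_of_region (hT : T.OrdConnected) (h0 : (0 : ℝ) ∈ T) (hq0 : ∀ j, 0 < q j)
    (hqm : StrictMono q) (hqy : ∀ j, q j < y j) (hyq : ∀ j, y j < q (j + 1))
    (hy : ∀ j < m, rootProd q m (-y j) ∉ T) {α β γ : ℝ} (hα : rootProd q m α ∈ T)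
    (hβ : rootProd q m β ∈ T) (hαγ : α ≤ γ) (hγβ : γ ≤ β) {p : ℕ} (hp : p ≤ m)
    (hβy : ∀ j < p, β < -y j) (hαy : ∀ j, p ≤ j → j < m → -y j ≤ α) : rootProd q m γ ∈ T := by
  have hmono := hqm.monotone
  rcases lt_trichotomy γ (-q p) with hγ | hγ | hγ
  · rcases hp.eq_or_lt with rfl | hp
    · have hlt : ∀ j < p + 1, γ < -q j := fun j hj => by
        have := hmono (Nat.lt_succ_iff.1 hj)
        linarith
      refine rootProd_mem_of_abs_le hT h0 hα (fun j hj => mul_pos_of_neg_of_neg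
        (one_add_div_neg (hq0 j) (hlt j hj)) (one_add_div_neg (hq0 j) ?_)) fun j hj => ?_
      · linarith [hlt j hj]
      · have h1 := one_add_div_neg (hq0 j) (hlt j hj)
        have h2 : α / q j ≤ γ / q j := div_le_div_of_nonneg_right hαγ (hq0 j).le
        rw [abs_of_neg h1, abs_of_neg (by linarith)]
        linarith
    · refine rootProd_mem_of_between hT h0 hα (hy p hp) ?_ fun j hj => ?_
      · rw [segment_symm, segment_eq_Icc ((hαy p le_rfl hp).trans hαγ)]
        exact ⟨hαy p le_rfl hp, hαγ⟩
      · have h1 := hαy p le_rfl hp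
        rcases le_or_gt j p with hjp | hjp
        · have := hmono hjp
          exact mul_pos_of_neg_of_neg (one_add_div_neg (hq0 j) (by linarith))
            (one_add_div_neg (hq0 j) (by linarith))
        · have h2 := hmono (Nat.succ_le_of_lt hjp)
          have := hyq p
          simp only [Nat.succ_eq_add_one] at h2
          exact mul_pos (one_add_div_pos (hq0 j) (by linarith))
            (one_add_div_pos (hq0 j) (by linarith))
  · have : rootProd q m γ = 0 := by
      refine Finset.prod_eq_zero (Finset.mem_range.2 (Nat.lt_succ_of_le hp)) ?_
      rw [hγ, neg_div, div_self (hq0 p).ne']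
      norm_num
    rwa [this]
  · rcases p with _ | p
    · have hlt : ∀ j, -q j < γ := fun j => by
        have := hmono (Nat.zero_le j)
        linarith
      refine rootProd_mem_of_abs_le hT h0 hβ (fun j hj => mul_pos
        (one_add_div_pos (hq0 j) (hlt j)) (one_add_div_pos (hq0 j) ?_)) fun j hj => ?_
      · linarith [hlt j]
      · have h1 := one_add_div_pos (hq0 j) (hlt j)
        have h2 : γ / q j ≤ β / q j := div_le_div_of_nonneg_right hγβ (hq0 j).le
        rw [abs_of_pos h1, abs_of_pos (by linarith)]
        linarith
    · have h1 := hβy p (Nat.lt_succ_self p)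
      refine rootProd_mem_of_between hT h0 hβ (hy p hp) ?_ fun j hj => ?_
      · rw [segment_eq_Icc (hγβ.trans h1.le)]
        exact ⟨hγβ, h1.le⟩
      · rcases le_or_gt j p with hjp | hjp
        · have := hmono hjp
          have := hqy p
          exact mul_pos_of_neg_of_neg (one_add_div_neg (hq0 j) (by linarith))
            (one_add_div_neg (hq0 j) (by linarith))
        · have h2 := hmono (Nat.succ_le_of_lt hjp)
          simp only [Nat.succ_eq_add_one] at h2
          exact mul_pos (one_add_div_pos (hq0 j) (by linarith))
            (one_add_div_pos (hq0 j) (by linarith))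

/-- If `rootProd q m` leaves `T` between any two consecutive roots, then each root has its own
component of the preimage of `T`. -/
theorem numComponents_rootProd_preimage (hT : T.OrdConnected) (h0 : (0 : ℝ) ∈ T)
    (hq0 : ∀ j, 0 < q j) (hqm : StrictMono q) (hqy : ∀ j, q j < y j)
    (hyq : ∀ j, y j < q (j + 1)) (hy : ∀ j < m, rootProd q m (-y j) ∉ T) {U : Set ℝ}
    (hU : U.OrdConnected) (hqU : ∀ j < m + 1, -q j ∈ U) :
    numComponents ({α | rootProd q m α ∈ T} ∩ U) = m + 1 := by
  have hymono : StrictMono y := strictMono_nat_of_lt_succ fun j => (hyq j).trans (hqy (j + 1))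
  -- The separators to the right of `α`; their number is the component index. It is locally constant
  -- on the preimage, which contains no separator.
  let Y : ℝ → Finset ℕ := fun α => (Finset.range m).filter fun j => α < -y j
  have hYmono : ∀ {α β : ℝ}, α ≤ β → Y β ⊆ Y α := fun hαβ j hj => by
    simp only [Y, Finset.mem_filter] at hj ⊢
    exact ⟨hj.1, hαβ.trans_lt hj.2⟩
  refine numComponents_eq_of_index (fun α => (Y α).card) ?_ ?_ ?_ ?_
  · intro α hα
    have hne : ∀ j < m, α ≠ -y j := fun j hj h => hy j hj (h ▸ hα.1)
    have hev : ∀ᶠ x in nhds α, ∀ j ∈ Finset.range m, (x < -y j ↔ α < -y j) := by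
      rw [Filter.eventually_all_finset]
      intro j hj
      rcases lt_or_gt_of_ne (hne j (Finset.mem_range.1 hj)) with h | h
      · filter_upwards [Iio_mem_nhds h] with x hx
        exact ⟨fun _ => h, fun _ => hx⟩
      · filter_upwards [Ioi_mem_nhds h] with x hx
        exact ⟨fun h' => absurd h' (not_lt.2 (le_of_lt hx)), fun h' => absurd h' (not_lt.2 h.le)⟩
    refine ContinuousAt.continuousWithinAt
      ((continuousAt_const (y := (Y α).card)).congr ?_)
    filter_upwards [hev] with x hx
    exact congrArg Finset.card (Finset.filter_congr fun j hj => (hx j hj).symm)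
  · intro α _
    exact Nat.lt_succ_of_le ((Finset.card_filter_le _ _).trans (Finset.card_range m).le)
  · intro j hj
    refine ⟨-q j, ⟨?_, hqU j hj⟩, ?_⟩
    · have : rootProd q m (-q j) = 0 := by
        refine Finset.prod_eq_zero (Finset.mem_range.2 hj) ?_
        rw [neg_div, div_self (hq0 j).ne']
        norm_num
      change rootProd q m (-q j) ∈ T
      rwa [this]
    · have : Y (-q j) = Finset.range j := by
        ext i
        simp only [Y, Finset.mem_filter, Finset.mem_range, neg_lt_neg_iff]
        constructor
        · rintro ⟨-, h⟩
          by_contra! hji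
          linarith [hqm.monotone hji, hqy i]
        · intro h
          exact ⟨by omega, (hyq i).trans_le (hqm.monotone h)⟩
      simp [this]
  · intro α hα β hβ hφ hαβ γ hγ
    refine ⟨?_, hU.out hα.2 hβ.2 hγ⟩
    have hYeq : Y β = Y α := Finset.eq_of_subset_of_card_le (hYmono hαβ) hφ.le
    -- The least such `p` is the index of the region; `p = m` stands for the leftmost one, which has
    -- no separator on its left.
    have hex : ∃ p, p = m ∨ -y p ≤ α := ⟨m, Or.inl rfl⟩
    have hpm : Nat.find hex ≤ m := Nat.find_min' hex (Or.inl rfl)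
    refine rootProd_mem_of_region hT h0 hq0 hqm hqy hyq hy hα.1 hβ.1 hγ.1 hγ.2 hpm
      (fun j hj => ?_) fun j hpj hj => ?_
    · have h1 := Nat.find_min hex hj
      push Not at h1
      have : j ∈ Y β := hYeq ▸ Finset.mem_filter.2 ⟨Finset.mem_range.2 (by omega), h1.2⟩
      exact (Finset.mem_filter.1 this).2
    · rcases Nat.find_spec hex with h1 | h1
      · omega
      · have := hymono.monotone hpj
        linarith

end

/-! ### Widely spaced roots and the resulting perturbation. -/

/-- With geometric spacing, factor `j` contributes `R - 1`, and each other factor is at least `1/2`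
because its ratio is at least `R` or at most `1/R`. -/
theorem le_abs_rootProd_pow {R : ℝ} (hR : 2 ≤ R) {m j : ℕ} (hj : j < m + 1) :
    (R - 1) * (1 / 2) ^ m ≤ |rootProd (fun i => R ^ (2 * i)) m (-R ^ (2 * j + 1))| := by
  have hR0 : 0 < R := by linarith
  rw [rootProd, Finset.abs_prod, ← Finset.mul_prod_erase _ _ (Finset.mem_range.2 hj)]
  refine mul_le_mul ?_ ?_ (by positivity) (abs_nonneg _)
  · rw [neg_div, pow_succ, mul_div_cancel_left₀ _ (by positivity)]
    refine le_trans (by linarith) (neg_le_abs _)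
  · have hcard : ((Finset.range (m + 1)).erase j).card = m := by
      rw [Finset.card_erase_of_mem (Finset.mem_range.2 hj), Finset.card_range, Nat.add_sub_cancel]
    calc ((1 / 2 : ℝ)) ^ m = ∏ i ∈ (Finset.range (m + 1)).erase j, (1 / 2 : ℝ) := by
          rw [Finset.prod_const, hcard]
      _ ≤ _ := by
          refine Finset.prod_le_prod (fun _ _ => by norm_num) fun i hi => ?_
          have hpos : 0 < R ^ (2 * i) := by positivity
          have hR1 : 1 ≤ R := by linarith
          rcases lt_or_gt_of_ne (Finset.ne_of_mem_erase hi) with hij | hij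
          · have h1 : R * R ^ (2 * i) ≤ R ^ (2 * j + 1) := by
              rw [← pow_succ']
              exact pow_le_pow_right₀ hR1 (by omega)
            have h2 : R ≤ R ^ (2 * j + 1) / R ^ (2 * i) := (le_div_iff₀ hpos).2 h1
            rw [neg_div]
            refine le_trans ?_ (neg_le_abs _)
            linarith
          · have h1 : R ^ (2 * j + 1) * R ≤ R ^ (2 * i) := by
              rw [← pow_succ]
              exact pow_le_pow_right₀ hR1 (by omega)
            have h2 : R ^ (2 * j + 1) / R ^ (2 * i) ≤ 1 / 2 := by
              rw [div_le_iff₀ hpos]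
              have : 0 < R ^ (2 * j + 1) := by positivity
              nlinarith
            rw [neg_div]
            refine le_trans ?_ (le_abs_self _)
            linarith

/-- Assign the reciprocals of `q 0, …, q m` to `m + 1` of the free links and leave all other links
unscaled. -/
theorem exists_link_factors {n m : ℕ} {D : Finset ℕ} (hD : D ⊆ Finset.range n)
    (hm : m + 1 ≤ D.card) (q : ℕ → ℝ) :
    ∃ h : ℕ → ℝ, (∀ i ∉ D, h i = 0) ∧
      ∀ α, ∏ i ∈ Finset.range n, (1 + α * h i) = rootProd q m α := by
  classical
  obtain ⟨E, hE, hcard⟩ := Finset.exists_subset_card_eq hm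
  let e : E ≃ Fin (m + 1) := E.equivFinOfCardEq hcard
  refine ⟨fun i => if hi : i ∈ E then (q (e ⟨i, hi⟩))⁻¹ else 0,
    fun i hi => dif_neg fun h => hi (hE h), fun α => ?_⟩
  rw [← Finset.prod_subset (hE.trans hD) fun i _ hi => by simp [hi],
    ← Finset.prod_coe_sort, rootProd, Finset.prod_range, ← Equiv.prod_comp e]
  refine Finset.prod_congr rfl fun i _ => ?_
  simp [div_eq_mul_inv]

/-- A perturbation with `m + 1` stable regions, provided that `p + C (β * t)` is stable for
bounded `t` only; a lower bound on `t` suffices if `m ≤ 1`. -/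
theorem exists_numComponents_eq_of_isThreeTerm {n : ℕ} (hn : 0 < n)
    {F : Matrix (Fin n) (Fin n) ℝ} (hJ : OneJordanBlockPerEigenvalue F)
    {B : ℕ → ℝ[X]} {a c : ℕ → ℝ} (hB : IsThreeTerm n B a c) {β : ℝ}
    (hβ : F.charpoly = B n + C β) (hp : PolyStable (B n)) {D : Finset ℕ}
    (hD : D ⊆ Finset.range n) (hc : ∀ i ∈ D, i + 1 < n → c (i + 1) = 0) {m : ℕ}
    (hm : m + 1 ≤ D.card) {K : ℝ} (hlow : ∀ t, PolyStable (B n + C (β * t)) → -K ≤ t)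
    (hup : m ≤ 1 ∨ ∀ t, PolyStable (B n + C (β * t)) → t ≤ K) :
    ∃ H : Matrix (Fin n) (Fin n) ℝ,
      numComponents (stabilityRegion F H) = m + 1 ∧
      numComponents (stabilityRegion F H ∩ Set.Iio 0) = m + 1 := by
  obtain ⟨R, hR, hRK⟩ : ∃ R : ℝ, 2 ≤ R ∧ K < (R - 1) * (1 / 2) ^ m := by
    -- Chosen so that `(R - 1) / 2 ^ m = |K| + 1 / 2 ^ m`.
    refine ⟨2 + |K| * 2 ^ m, by linarith [show 0 ≤ |K| * 2 ^ m by positivity], ?_⟩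
    have h1 : (2 + |K| * 2 ^ m - 1) * (1 / 2) ^ m = |K| + (1 / 2) ^ m := by
      rw [one_div, inv_pow]
      field_simp
      ring
    rw [h1]
    have := le_abs_self K
    have : (0 : ℝ) < (1 / 2) ^ m := by positivity
    linarith
  have hR0 : 0 < R := by linarith
  have hR1 : 1 < R := by linarith
  set q : ℕ → ℝ := fun i => R ^ (2 * i) with hq
  set y : ℕ → ℝ := fun i => R ^ (2 * i + 1) with hy
  obtain ⟨hmon, hdeg⟩ := hB.monic_natDegree n le_rfl
  have hd0 : (B n).natDegree ≠ 0 := by omega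
  obtain ⟨h, hh0, hh⟩ := exists_link_factors hD hm q
  obtain ⟨H, hH⟩ := hB.exists_matrix_deformation hn hJ hβ h fun i hi => by
    by_cases hiD : i ∈ D
    · rw [hc i hiD hi, zero_mul]
    · rw [hh0 i hiD, mul_zero]
  set T : Set ℝ := {t : ℝ | PolyStable (B n + C (β * t))} with hTdef
  have hT : T.OrdConnected := ordConnected_setOf_polyStable hmon hd0 β
  have h0 : (0 : ℝ) ∈ T := by
    change PolyStable (B n + C (β * 0))
    simpa using hp
  have hS : stabilityRegion F H = {α | rootProd q m α ∈ T} := by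
    ext α
    change MatrixStable _ ↔ PolyStable (B n + C (β * rootProd q m α))
    rw [matrixStable_iff_polyStable_charpoly, hH, hh]
  have hq0 : ∀ j, 0 < q j := fun j => pow_pos hR0 _
  have hqm : StrictMono q := fun i j hij => pow_lt_pow_right₀ hR1 (by omega)
  have hqy : ∀ j, q j < y j := fun j => pow_lt_pow_right₀ hR1 (by omega)
  have hyq : ∀ j, y j < q (j + 1) := fun j => pow_lt_pow_right₀ hR1 (by omega)
  have hout : ∀ j < m, rootProd q m (-y j) ∉ T := by
    intro j hj hmem
    have h1 : (R - 1) * (1 / 2) ^ m ≤ |rootProd q m (-y j)| :=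
      le_abs_rootProd_pow hR (hj.trans (Nat.lt_succ_self m))
    have h2 := hlow _ hmem
    rcases hup with hm1 | hup
    · obtain rfl : m = 1 := by omega
      obtain rfl : j = 0 := by omega
      -- With only two roots the product is negative between them, so the lower bound on `T` alone
      -- excludes this value.
      have h3 : rootProd q 1 (-y 0) < 0 := by
        rw [rootProd, Finset.prod_range_succ, Finset.prod_range_one]
        exact mul_neg_of_neg_of_pos (one_add_div_neg (hq0 0) (neg_lt_neg (hqy 0)))
          (one_add_div_pos (hq0 1) (neg_lt_neg (hyq 0)))
      rw [abs_of_neg h3] at h1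
      linarith
    · have := abs_le.2 ⟨h2, hup _ hmem⟩
      linarith
  have hcount := fun U hU hqU =>
    numComponents_rootProd_preimage hT h0 hq0 hqm hqy hyq hout (U := U) hU hqU
  refine ⟨H, ?_, ?_⟩
  · have := hcount Set.univ Set.ordConnected_univ fun j _ => Set.mem_univ _
    rwa [Set.inter_univ, ← hS] at this
  · have := hcount (Set.Iio 0) Set.ordConnected_Iio fun j _ => neg_lt_zero.2 (hq0 j)
    rwa [← hS] at this

/-! ### Degree two and the final assembly. -/

theorem PolyStable.pos_of_quadratic {b c : ℝ} (h : PolyStable (X ^ 2 + C b * X + C c)) :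
    0 < b ∧ 0 < c := by
  have hc : 0 < c := by
    by_contra! hc
    have hdisc : 0 ≤ b ^ 2 - 4 * c := by nlinarith [sq_nonneg b]
    have hsq := Real.sq_sqrt hdisc
    have hle : b ≤ √(b ^ 2 - 4 * c) :=
      (le_abs_self b).trans (Real.abs_le_sqrt (by linarith))
    set r := √(b ^ 2 - 4 * c)
    have := h (((-b + r) / 2 : ℝ) : ℂ) (by
      have : ((-b + r) / 2) ^ 2 + b * ((-b + r) / 2) + c = 0 := by linear_combination hsq / 4
      simp only [map_add, map_mul, map_pow, aeval_X, aeval_C, Complex.coe_algebraMap]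
      exact_mod_cast this)
    rw [Complex.ofReal_re] at this
    linarith
  refine ⟨?_, hc⟩
  obtain ⟨z, hz⟩ : ∃ z : ℂ, aeval z (X ^ 2 + C b * X + C c : ℝ[X]) = 0 := by
    refine IsAlgClosed.exists_aeval_eq_zero _ _ ?_
    rw [show (X ^ 2 + C b * X + C c : ℝ[X]).degree = 2 by compute_degree!]
    norm_num
  have h1 := h z hz
  have h2 := h (-b - z) (by
    simp only [map_add, map_mul, map_pow, aeval_X, aeval_C, Complex.coe_algebraMap] at hz ⊢
    linear_combination hz)
  simp at h2
  linarith

theorem polyStable_mul_linear {u v : ℝ} (hu : 0 < u) (hv : 0 < v) :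
    PolyStable ((X + C u) * (X + C v)) := by
  intro z hz
  simp only [map_add, map_mul, aeval_X, aeval_C, Complex.coe_algebraMap] at hz
  rcases mul_eq_zero.1 hz with h | h
  · rw [eq_neg_of_add_eq_zero_left h]
    simpa using hu
  · rw [eq_neg_of_add_eq_zero_left h]
    simpa using hv

/-- Quadratics with positive coefficients are stable however large the constant term, so the shift
`β` must be positive for `T` to be bounded below. A given `β₀` may be negative; a new `β` comes from
lowering the constant term of `F.charpoly` to `ε (b - ε)`, which also gives two real roots and so
two free links. -/
theorem exists_two_components {F : Matrix (Fin 2) (Fin 2) ℝ} (hF : MatrixStable F)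
    (hJ : OneJordanBlockPerEigenvalue F) :
    ∃ H : Matrix (Fin 2) (Fin 2) ℝ,
      numComponents (stabilityRegion F H) = 2 ∧
      numComponents (stabilityRegion F H ∩ Set.Iio 0) = 2 := by
  obtain ⟨b, c, hbc⟩ : ∃ b c : ℝ, F.charpoly = X ^ 2 + C b * X + C c := by
    refine ⟨-F.trace, F.det, ?_⟩
    rw [Matrix.charpoly_fin_two, map_neg]
    ring
  have hst := (matrixStable_iff_polyStable_charpoly F).1 hF
  rw [hbc] at hst
  obtain ⟨hb, hc⟩ := hst.pos_of_quadratic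
  obtain ⟨ε, hε, hεb, hεc⟩ : ∃ ε > 0, ε < b ∧ ε * (b - ε) < c := by
    have hpos : 0 < b ^ 2 + c := by positivity
    -- Any positive `ε` with `ε < b` and `ε b < c` would do.
    refine ⟨b * c / (b ^ 2 + c), by positivity, ?_, ?_⟩
    · rw [div_lt_iff₀ hpos]
      nlinarith [pow_pos hb 3]
    · have h1 : b * c / (b ^ 2 + c) * b < c := by
        rw [div_mul_eq_mul_div, div_lt_iff₀ hpos]
        nlinarith [pow_pos hc 2]
      have h2 : 0 < b * c / (b ^ 2 + c) := by positivity
      nlinarith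
  set β := c - ε * (b - ε) with hβ
  have hβ0 : 0 < β := by linarith
  let B : ℕ → ℝ[X] := fun i =>
    if i = 0 then 1 else if i = 1 then X + C ε else (X + C ε) * (X + C (b - ε))
  have hB : IsThreeTerm 2 B (fun i => if i = 0 then -ε else -(b - ε)) 0 := by
    refine ⟨rfl, fun i hi => ?_⟩
    interval_cases i
    · simp [B]
    · simp [B]
      ring
  have hB2 : B 2 = (X + C ε) * (X + C (b - ε)) := rfl
  have hexp : ∀ s : ℝ, B 2 + C s = X ^ 2 + C b * X + C (ε * (b - ε) + s) := fun s => by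
    rw [hB2]
    simp only [map_add, map_mul, map_sub]
    ring
  refine exists_numComponents_eq_of_isThreeTerm two_pos hJ hB (β := β) (m := 1)
    (D := Finset.range 2) (K := ε * (b - ε) / β) ?_ ?_ subset_rfl (fun _ _ _ => rfl) (by simp)
    (fun t ht => ?_) (Or.inl le_rfl)
  · rw [hexp, hbc, hβ, add_sub_cancel]
  · exact polyStable_mul_linear hε (by linarith)
  · rw [hexp] at ht
    have := ht.pos_of_quadratic.2
    rw [neg_le_iff_add_nonneg, add_comm, div_add' _ _ _ hβ0.ne']
    exact div_nonneg (by linarith) hβ0.le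

theorem numComponents_eq_one {S : Set ℝ} (hS : S.OrdConnected) (hne : S.Nonempty) :
    numComponents S = 1 := by
  refine numComponents_eq_of_index (fun _ => 0) continuousOn_const (fun _ _ => one_pos)
    (fun j hj => ?_) fun α hα β hβ _ _ => hS.out hα hβ
  obtain ⟨α, hα⟩ := hne
  exact ⟨α, hα, by omega⟩

theorem theorem2 (n : ℕ) (F : Matrix (Fin n) (Fin n) ℝ)
    (hF : MatrixStable F) (hJ : OneJordanBlockPerEigenvalue F)
    (β₀ : ℝ) (hβ₀ : β₀ ≠ 0) (hp : PolyStable (F.charpoly - C β₀))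
    (nᵢ : ℕ) (hnᵢ : conjugatePairs (F.charpoly - C β₀) = nᵢ) :
    ∃ H : Matrix (Fin n) (Fin n) ℝ,
      numComponents (stabilityRegion F H) = (n - nᵢ) / 2 + 1 ∧
      numComponents (stabilityRegion F H ∩ Set.Iio 0) = (n - nᵢ) / 2 + 1 := by
  rcases Nat.eq_zero_or_pos ((n - nᵢ) / 2) with hm | hm
  · have hS : stabilityRegion F 0 = Set.univ := by
      ext α
      simp [stabilityRegion, hF]
    rw [hm, zero_add]
    refine ⟨0, ?_, ?_⟩
    · rw [hS]
      exact numComponents_eq_one Set.ordConnected_univ Set.univ_nonempty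
    · rw [hS, Set.univ_inter]
      exact numComponents_eq_one Set.ordConnected_Iio ⟨-1, by simp⟩
  by_cases hn2 : n = 2
  · subst hn2
    rw [show (2 - nᵢ) / 2 = 1 by omega]
    exact exists_two_components hF hJ
  have hn3 : 3 ≤ n := by omega
  have hFm : F.charpoly.Monic := F.charpoly_monic
  have hFd : F.charpoly.natDegree = n := by simp [Matrix.charpoly_natDegree_eq_dim]
  have hpm : (F.charpoly - C β₀).Monic := by
    refine hFm.sub_of_left (lt_of_le_of_lt degree_C_le ?_)
    rw [degree_eq_natDegree hFm.ne_zero, hFd]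
    exact_mod_cast (by omega : 0 < n)
  have hpd : (F.charpoly - C β₀).natDegree = n := by rw [natDegree_sub_C, hFd]
  obtain ⟨B, a, c, D, hB, hBn, hD, hc, hcard⟩ := exists_isThreeTerm n _ hpm hpd
  obtain ⟨K, hK⟩ := exists_bound_of_polyStable hpm (by omega)
  have hbound : ∀ t, PolyStable (B n + C (β₀ * t)) → |t| ≤ K / |β₀| := by
    intro t ht
    rw [hBn] at ht
    rw [le_div_iff₀ (abs_pos.2 hβ₀), mul_comm, ← abs_mul]
    exact hK _ ht
  -- There are at least `n - nᵢ` free links, and this is at least `(n - nᵢ) / 2 + 1` because the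
  -- quotient is positive here.
  exact exists_numComponents_eq_of_isThreeTerm (by omega) hJ hB
    (by rw [hBn, sub_add_cancel]) (hBn ▸ hp) hD hc (by omega)
    (fun t ht => (abs_le.1 (hbound t ht)).1) (Or.inr fun t ht => (abs_le.1 (hbound t ht)).2)
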